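/- Let $N\ge 2$. A formal real hypersurface $M\subset\mathbb C^N$ is given by a power series $r\in\mathbb C[[Z,\zeta]]$, $Z,\zeta\in\mathbb C^N$, with $r(Z,\zeta)=\bar r(\zeta,Z)$ (the bar denotes conjugation of the coefficients), $r(0)=0$ and $\partial_Z r(0)\neq 0$. Put $\mathcal I(M)=(r)\subset\mathbb C[[Z,\zeta]]$ and $T^{1,0}_0M=\ker\partial_Z r(0)\subset T_0\mathbb C^N=\mathbb C^N$. Normal coordinates for $M$ are a formal change of coordinates $Z=Z(z,w)$, $(z,w)\in\mathbb C^{N-1}\times\mathbb C$, fixing the origin, such that in the coordinates $(Z,\zeta)=(Z(z,w),\bar Z(\chi,\tau))$ the ideal $\mathcal I(M)$ is generated by $w-Q(z,\chi,\tau)$, where $Q\in\mathbb C[[z,\chi,\tau]]$ satisfies $Q(0,\chi,\tau)=Q(z,0,\tau)=\tau$. One says that $M$ belongs to the class $\mathcal C$ if in some such coordinates (the condition does not depend on their choice), for all sufficiently large $k$, the formal map $\chi\mapsto (Q_{z^\alpha}(0,\chi,0))_{|\alpha|\le k}$ has generic rank $N-1$, i.e. its Jacobian matrix has rank $N-1$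 over $\mathbb C[[\chi]]$. A formal holomorphic map $H\colon(\mathbb C^N,0)\to(\mathbb C^N,0)$ sends $M$ into $M'$ if $h(H(Z),\bar H(\zeta))\in\mathcal I(M)$ for every $h\in\mathcal I(M')$, and such an $H$ is CR-transversal if $T^{1,0}_0M'+dH(T_0\mathbb C^N)=T_0\mathbb C^N$, where $dH$ is the differential of $H$ at $0$. Corollary 2.3. Let $M,M'\subset\mathbb C^N$ be formal real hypersurfaces with $M$ belonging to the class $\mathcal C$. Then every formal holomorphic map $H\colon(\mathbb C^N,0)\to(\mathbb C^N,0)$ sending $M$ into $M'$ whose Jacobian determinant $\operatorname{Jac}H$ is not identically zero is CR-transversal. -/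

import Mathlib

noncomputable section

namespace FormalCR

/-- A formal holomorphic map `(ℂ^σ, 0) → (ℂ^τ, 0)`: a `τ`-tuple of formal power series in the
variables indexed by `σ`, all with zero constant term. -/
structure FormalMap (σ τ : Type) where
  /-- the components of the map -/
  comp : τ → MvPowerSeries σ ℂ
  /-- the map sends the origin to the origin -/
  map_zero : ∀ j, MvPowerSeries.constantCoeff (comp j) = 0

/-- The power series `f̄`, obtained from `f` by conjugating the coefficients. -/
def conjSeries {σ : Type} (f : MvPowerSeries σ ℂ) : MvPowerSeries σ ℂ :=
  MvPowerSeries.map (starRingEnd ℂ) f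

/-- The involution `(σ f)(Z, ζ) = f̄(ζ, Z)` of `ℂ⟦Z, ζ⟧`. The variables `Z` are indexed by the left
summand and the variables `ζ` by the right one. -/
def involution {ι : Type} (f : MvPowerSeries (ι ⊕ ι) ℂ) : MvPowerSeries (ι ⊕ ι) ℂ :=
  MvPowerSeries.renameEquiv ℂ (Equiv.sumComm ι ι) (conjSeries f)

/-- The Jacobian matrix `∂F/∂x` of a tuple of formal power series in `x`. -/
def jacobian {σ τ : Type} (F : τ → MvPowerSeries σ ℂ) : Matrix τ σ (MvPowerSeries σ ℂ) :=
  Matrix.of fun i j => MvPowerSeries.pderiv ℂ j (F i)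

/-- The generic rank of a formal map: the rank of its Jacobian matrix, regarded as a
`ℂ⟦x⟧`-linear map. -/
def genericRank {σ τ : Type} [Fintype σ] (F : τ → MvPowerSeries σ ℂ) : ℕ :=
  (jacobian F).rank

/-- The iterated partial derivative `∂^α f`. -/
def iteratedPDeriv {σ : Type} [Fintype σ] (α : σ →₀ ℕ) (f : MvPowerSeries σ ℂ) :
    MvPowerSeries σ ℂ :=
  fun d => MvPowerSeries.coeff (d + α) f * ∏ i, (((d i + α i).descFactorial (α i) : ℕ) : ℂ)

theorem iteratedPDeriv_zero {σ : Type} [Fintype σ] (f : MvPowerSeries σ ℂ) :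
    iteratedPDeriv 0 f = f := by
  ext d
  simp [iteratedPDeriv, MvPowerSeries.coeff_apply]

theorem iteratedPDeriv_add_single {σ : Type} [Fintype σ] [DecidableEq σ] (α : σ →₀ ℕ) (i : σ)
    (f : MvPowerSeries σ ℂ) :
    iteratedPDeriv (α + Finsupp.single i 1) f =
      MvPowerSeries.pderiv ℂ i (iteratedPDeriv α f) := by
  ext d
  have key : ∏ j, ((d j + (α + Finsupp.single i 1 : σ →₀ ℕ) j).descFactorial
        ((α + Finsupp.single i 1 : σ →₀ ℕ) j)) =
      (∏ j, (((d + Finsupp.single i 1 : σ →₀ ℕ) j + α j).descFactorial (α j))) * (d i + 1) := by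
    rw [← Finset.prod_erase_mul _ _ (Finset.mem_univ i),
      ← Finset.prod_erase_mul (f := fun j => ((d + Finsupp.single i 1 : σ →₀ ℕ) j + α j).descFactorial (α j))
        _ (Finset.mem_univ i), mul_assoc]
    congr 1
    · refine Finset.prod_congr rfl fun j hj => ?_
      have : Finsupp.single i 1 j = 0 := Finsupp.single_eq_of_ne (Finset.ne_of_mem_erase hj)
      simp [this]
    · simp only [Finsupp.add_apply, Finsupp.single_eq_same]
      rw [Nat.descFactorial_succ, show d i + (α i + 1) = d i + 1 + α i by omega,
        Nat.add_sub_cancel, mul_comm]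
  rw [MvPowerSeries.coeff_pderiv]
  simp only [iteratedPDeriv, MvPowerSeries.coeff_apply]
  have key' := congrArg (Nat.cast : ℕ → ℂ) key
  push_cast at key' ⊢
  rw [key', show d + (α + Finsupp.single i 1) = d + Finsupp.single i 1 + α by abel]
  ring

namespace FormalMap

variable {σ τ ρ : Type}

theorem hasSubst [Finite τ] (F : FormalMap σ τ) : MvPowerSeries.HasSubst F.comp :=
  MvPowerSeries.hasSubst_of_constantCoeff_zero F.map_zero

/-- The ring homomorphism `h ↦ h ∘ F` from `ℂ⟦x'⟧` to `ℂ⟦x⟧`. -/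
def pullback [Finite τ] (F : FormalMap σ τ) : MvPowerSeries τ ℂ →ₐ[ℂ] MvPowerSeries σ ℂ :=
  MvPowerSeries.substAlgHom F.hasSubst

/-- The pushforward `F_* I = {h : h ∘ F ∈ I}` of an ideal. -/
def pushforward [Finite τ] (F : FormalMap σ τ) (I : Ideal (MvPowerSeries σ ℂ)) :
    Ideal (MvPowerSeries τ ℂ) :=
  I.comap F.pullback

/-- The identity map. -/
def id (σ : Type) : FormalMap σ σ where
  comp := MvPowerSeries.X
  map_zero := by simp

/-- The composition `G ∘ F`. -/
def after [Finite τ] (G : FormalMap τ ρ) (F : FormalMap σ τ) : FormalMap σ ρ where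
  comp j := F.pullback (G.comp j)
  map_zero j := by
    rw [pullback, MvPowerSeries.substAlgHom_apply]
    exact MvPowerSeries.constantCoeff_subst_eq_zero F.hasSubst F.map_zero (G.map_zero j)

/-- A formal change of coordinates: a formal map that has a formal inverse. -/
def IsChangeOfCoordinates [Finite σ] (F : FormalMap σ σ) : Prop :=
  ∃ G : FormalMap σ σ, G.after F = FormalMap.id σ ∧ F.after G = FormalMap.id σ

/-- The complexification `(Z, ζ) ↦ (H(Z), H̄(ζ))` of a formal map `H`. -/
def double [Finite σ] (H : FormalMap σ τ) : FormalMap (σ ⊕ σ) (τ ⊕ τ) where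
  comp := Sum.elim (fun j => MvPowerSeries.rename Sum.inl (H.comp j))
    (fun j => MvPowerSeries.rename Sum.inr (conjSeries (H.comp j)))
  map_zero := by
    rintro (j | j) <;> simp [conjSeries, H.map_zero]

/-- The Jacobian determinant `Jac H`. -/
def jac [Fintype σ] [DecidableEq σ] (H : FormalMap σ σ) : MvPowerSeries σ ℂ :=
  (jacobian H.comp).det

/-- The differential `dH` of `H` at the origin. -/
def differential [Fintype σ] (H : FormalMap σ τ) : (σ → ℂ) →ₗ[ℂ] (τ → ℂ) :=
  ((jacobian H.comp).map MvPowerSeries.constantCoeff).mulVecLin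

end FormalMap

/-- A formal real hypersurface through the origin of `ℂ^N`, given by a defining power series
`r(Z, ζ)`. -/
structure FormalRealHypersurface (N : ℕ) where
  /-- the defining power series -/
  r : MvPowerSeries (Fin N ⊕ Fin N) ℂ
  /-- `r` is real, that is, invariant under the involution -/
  real : involution r = r
  /-- the hypersurface passes through the origin -/
  zero : MvPowerSeries.constantCoeff r = 0
  /-- the gradient of `r` with respect to `Z` does not vanish at the origin -/
  gradient : ∃ j : Fin N,
    MvPowerSeries.constantCoeff (MvPowerSeries.pderiv ℂ (Sum.inl j) r) ≠ 0

namespace FormalRealHypersurface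

/-- The ideal `𝓘(M)` generated by the defining power series. -/
def ideal {N : ℕ} (M : FormalRealHypersurface N) : Ideal (MvPowerSeries (Fin N ⊕ Fin N) ℂ) :=
  Ideal.span {M.r}

/-- The space `T₀^{1,0} M`: the kernel of the linear form `∂_Z r(0)` on `T₀ ℂ^N = ℂ^N`. -/
def tangent10 {N : ℕ} (M : FormalRealHypersurface N) : Submodule ℂ (Fin N → ℂ) :=
  LinearMap.ker (∑ j : Fin N,
    MvPowerSeries.constantCoeff (MvPowerSeries.pderiv ℂ (Sum.inl j) M.r) •
      (LinearMap.proj j : (Fin N → ℂ) →ₗ[ℂ] ℂ))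

/-- Normal coordinates `Z = (z, w) ∈ ℂ^n × ℂ` for a formal real hypersurface `M` of `ℂ^{n+1}`,
where `w` is the last coordinate: a formal change of coordinates `Z = Z(z, w)` such that in the
coordinates `(Z(z, w), Z̄(χ, τ))` the ideal of `M` is generated by `w - Q(z, χ, τ)`, with
`Q(0, χ, τ) = Q(z, 0, τ) = τ`. In `Q`, the left summand `Fin n` indexes `z`, and the right summand
`Fin (n + 1)` indexes `(χ, τ)`, with `τ` last. -/
structure NormalCoordinates {n : ℕ} (M : FormalRealHypersurface (n + 1)) where
  /-- the change of coordinates `Z = Z(z, w)` -/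
  Z : FormalMap (Fin (n + 1)) (Fin (n + 1))
  isChange : Z.IsChangeOfCoordinates
  /-- the power series `Q(z, χ, τ)` -/
  Q : MvPowerSeries (Fin n ⊕ Fin (n + 1)) ℂ
  /-- `Q(0, χ, τ) = τ` -/
  normal_left : MvPowerSeries.subst
    (Sum.elim (fun _ => 0) MvPowerSeries.X :
      Fin n ⊕ Fin (n + 1) → MvPowerSeries (Fin (n + 1)) ℂ) Q = MvPowerSeries.X (Fin.last n)
  /-- `Q(z, 0, τ) = τ`, as an identity in `ℂ⟦z, τ⟧` with `τ` as the last variable -/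
  normal_right : MvPowerSeries.subst
    (Sum.elim (fun i => MvPowerSeries.X i.castSucc)
        (Fin.lastCases (MvPowerSeries.X (Fin.last n)) fun _ => 0) :
      Fin n ⊕ Fin (n + 1) → MvPowerSeries (Fin (n + 1)) ℂ) Q = MvPowerSeries.X (Fin.last n)
  /-- `M` is defined by `w = Q(z, χ, τ)` in these coordinates -/
  defining : Ideal.span {Z.double.pullback M.r} =
    Ideal.span {MvPowerSeries.X (Sum.inl (Fin.last n)) -
      MvPowerSeries.rename (Sum.map Fin.castSucc _root_.id) Q}

/-- The power series `Q_{z^α}(0, χ, 0)` in `χ`. -/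
def NormalCoordinates.coeffSeries {n : ℕ} {M : FormalRealHypersurface (n + 1)}
    (c : M.NormalCoordinates) (α : Fin n →₀ ℕ) : MvPowerSeries (Fin n) ℂ :=
  MvPowerSeries.subst
    (Sum.elim (fun _ => 0) (Fin.lastCases 0 MvPowerSeries.X) :
      Fin n ⊕ Fin (n + 1) → MvPowerSeries (Fin n) ℂ)
    (iteratedPDeriv (α.mapDomain Sum.inl) c.Q)

/-- `M` belongs to the class `𝒞`: in some normal coordinates, for all sufficiently large `k`, the
map `χ ↦ (Q_{z^α}(0, χ, 0))_{|α| ≤ k}` has generic rank `n = N - 1`. -/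
def InClassC {n : ℕ} (M : FormalRealHypersurface (n + 1)) : Prop :=
  ∃ c : M.NormalCoordinates, ∃ k₀ : ℕ, ∀ k ≥ k₀,
    genericRank (fun α : {α : Fin n →₀ ℕ // α.degree ≤ k} => c.coeffSeries α) = n

end FormalRealHypersurface

/-- `H` sends `M` into `M'`: `𝓘(M')` is contained in the pushforward of `𝓘(M)` under the
complexification of `H`. -/
def SendsInto {N : ℕ} (H : FormalMap (Fin N) (Fin N)) (M M' : FormalRealHypersurface N) : Prop :=
  M'.ideal ≤ H.double.pushforward M.ideal

/-- `H` is CR-transversal to `M'`: `T₀^{1,0} M' + dH(T₀ ℂ^N) = T₀ ℂ^N`. -/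
def IsCRTransversal {N : ℕ} (H : FormalMap (Fin N) (Fin N)) (M' : FormalRealHypersurface N) :
    Prop :=
  M'.tangent10 ⊔ LinearMap.range H.differential = ⊤

end FormalCR

end

/-! Write `r' ∘ (H, H̄) = a r`. Transversality amounts to `a(0) ≠ 0`
(`isCRTransversal_of_constantCoeff_ne_zero`). Differentiating in `Z`, and in `ζ`, and using that the
gradients of `r'` do not vanish at the origin, puts both `Jac H(Z)` and its conjugate in `ζ` into
the ideal `(a, r)` (`rename_jac_mem`). On the graph `w = Q(z, χ, τ)` the series `r` vanishes. So the
restriction `A` of `a` divides both `j(z, Q(z, χ, τ))` and `j̄(χ, τ)`, where `j ≠ 0` is `Jac H` in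
normal coordinates. The core is `constantCoeff_ne_zero_of_dvd`: such an `A` is a unit. Suppose it is
not. Restrict to generic lines `z = cs`, `χ = c't`. A nonunit divisor of a nonzero series in `(t,
τ)` has a prime factor `p(t, τ)` (`exists_prime_rename_dvd`). With `j = w^l g` and `w ∤ g`, this `p`
divides `q` or `g(cs, q)`, where `q` is the restricted `Q`. If `p ∣ q`, then `s = 0` gives `p ∣ τ`,
so `p` is `τ` up to a unit and `q` vanishes at `τ = 0`, against `Q(z, χ, 0) ≠ 0`. If `p ∣ g(cs, q)`,
then `t = τ = 0` gives `g(cs, 0) = 0`, against `w ∤ g`. The class `𝒞` enters through `Q(z, χ, 0) ≠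
0` (`killCompl_Q_ne_zero`). -/

open MvPowerSeries

/-! ### Prime factors of divisors of constants in power series rings -/

/-- The multiples of `p` form the kernel of coefficientwise reduction to series over the domain
`R/(p)`. -/
theorem PowerSeries.prime_C {R : Type*} [CommRing R] [IsDomain R] {p : R} (hp : Prime p) :
    Prime (PowerSeries.C p) := by
  have key : ∀ f : PowerSeries R, PowerSeries.C p ∣ f ↔
      PowerSeries.map (Ideal.Quotient.mk (Ideal.span {p})) f = 0 := by
    intro f
    constructor
    · rintro ⟨g, rfl⟩
      rw [map_mul, PowerSeries.map_C, Ideal.Quotient.mk_singleton_self, map_zero, zero_mul]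
    · intro h
      have h' : ∀ k, p ∣ PowerSeries.coeff k f := by
        intro k
        have := congrArg (PowerSeries.coeff k) h
        rw [PowerSeries.coeff_map, map_zero, Ideal.Quotient.eq_zero_iff_mem,
          Ideal.mem_span_singleton] at this
        exact this
      choose g hg using h'
      refine ⟨PowerSeries.mk g, ?_⟩
      ext k
      rw [PowerSeries.coeff_C_mul, PowerSeries.coeff_mk, hg]
  have : (Ideal.span {p}).IsPrime := (Ideal.span_singleton_prime hp.ne_zero).2 hp
  refine ⟨fun h => hp.ne_zero (by simpa using congrArg PowerSeries.constantCoeff h), fun h =>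
    hp.not_isUnit (by simpa using h.map PowerSeries.constantCoeff), fun f g h => ?_⟩
  rw [key, map_mul, mul_eq_zero] at h
  rwa [key, key]

/-- A nonunit series in `R⟦X⟧` that divides a nonzero constant of the factorial ring `R` has a
prime factor in `R`. -/
theorem PowerSeries.exists_prime_C_dvd {R : Type*} [CommRing R] [IsDomain R]
    [UniqueFactorizationMonoid R] {f : PowerSeries R} {y : R} (hy : y ≠ 0)
    (hf : ¬ IsUnit f) (h : f ∣ PowerSeries.C y) :
    ∃ p : R, Prime p ∧ PowerSeries.C p ∣ f := by
  obtain ⟨g, hg⟩ := h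
  have h0 : constantCoeff f * constantCoeff g = y := by
    simpa using (congrArg constantCoeff hg).symm
  have hf0 : constantCoeff f ≠ 0 := fun h => hy (by rw [← h0, h, zero_mul])
  have hg0 : constantCoeff g ≠ 0 := fun h => hy (by rw [← h0, h, mul_zero])
  have hfu : ¬ IsUnit (constantCoeff f) := fun h => hf (PowerSeries.isUnit_iff_constantCoeff.2 h)
  obtain ⟨p, hp, hpf⟩ := WfDvdMonoid.exists_irreducible_factor hfu hf0
  replace hp := UniqueFactorizationMonoid.irreducible_iff_prime.1 hp
  have hP := PowerSeries.prime_C hp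
  refine ⟨p, hp, ?_⟩
  -- Cancel the full power of `p` from the cofactor `g`. What remains, `f * g₁`, is still a
  -- constant, and `p` divides it because `p` divides the constant term of `f`; since `p ∤ g₁`, it
  -- divides `f`.
  have hfin : FiniteMultiplicity (C p) g := by
    obtain ⟨m, hm⟩ := FiniteMultiplicity.of_not_isUnit hp.not_isUnit hg0
    refine ⟨m, fun h => hm ?_⟩
    simpa using map_dvd constantCoeff h
  obtain ⟨g₁, hgg, hg₁⟩ := hfin.exists_eq_pow_mul_and_not_dvd
  set m := multiplicity (C p) g
  have hgg0 : constantCoeff g = p ^ m * constantCoeff g₁ := by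
    simpa using congrArg constantCoeff hgg
  have hpm : (C p) ^ m ≠ 0 := pow_ne_zero _ hP.ne_zero
  have e : f * g₁ = C (constantCoeff f * constantCoeff g₁) := by
    apply mul_left_cancel₀ hpm
    calc C p ^ m * (f * g₁) = f * g := by rw [hgg]; ring
      _ = C y := hg.symm
      _ = _ := by rw [← h0, hgg0]; simp only [map_mul, map_pow]; ring
  have hd : C p ∣ f * g₁ := by
    rw [e]
    exact map_dvd C (hpf.mul_right _)
  exact (hP.dvd_or_dvd hd).resolve_right hg₁

/-! ### Series in two and three variables, coordinate restrictions, generic lines -/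

namespace MvPowerSeries

instance {σ : Type*} : IsDomain (MvPowerSeries σ ℂ) := NoZeroDivisors.to_isDomain _

theorem rename_some_eq {σ : Type*} [Finite σ] (f : MvPowerSeries σ ℂ) :
    optionEquivLeft σ ℂ (rename some f) = PowerSeries.C f := by
  classical
  ext k x
  rw [coeff_coeff_optionEquivLeft, PowerSeries.coeff_C]
  split_ifs with hk
  · have : x.optionElim k = Finsupp.embDomain Function.Embedding.some x := by
      subst hk
      ext i
      cases i with
      | none => rw [Finsupp.embDomain_of_notMem_range]; simp; simp
      | some i =>
        rw [Finsupp.optionElim_apply_some]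
        exact (Finsupp.embDomain_apply_self Function.Embedding.some x i).symm
    rw [this]
    exact coeff_embDomain_rename Function.Embedding.some f x
  · rw [map_zero]
    refine coeff_rename_eq_zero _ _ ?_
    rintro ⟨y, hy⟩
    apply hk
    have := DFunLike.congr_fun hy none
    rw [Finsupp.mapDomain_of_notMem_range _ _ (by simp)] at this
    simpa using this.symm

instance : UniqueFactorizationMonoid (MvPowerSeries (Option Unit) ℂ) :=
  have : UniqueFactorizationMonoid (PowerSeries (MvPowerSeries Unit ℂ)) :=
    inferInstanceAs (UniqueFactorizationMonoid (PowerSeries (PowerSeries ℂ)))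
  (optionEquivLeft Unit ℂ).toMulEquiv.symm.uniqueFactorizationMonoid this

/-- The variable `none` plays the role of `s`: the three-variable ring is `R⟦s⟧` with `R` the
factorial ring of series in the other two, and `rename some` embeds the constants `R`. -/
theorem exists_prime_rename_dvd {f : MvPowerSeries (Option (Option Unit)) ℂ}
    {y : MvPowerSeries (Option Unit) ℂ} (hy : y ≠ 0) (hf : constantCoeff f = 0)
    (h : f ∣ rename some y) :
    ∃ p : MvPowerSeries (Option Unit) ℂ, Prime p ∧ constantCoeff p = 0 ∧
      Prime (rename some p : MvPowerSeries (Option (Option Unit)) ℂ) ∧ rename some p ∣ f := by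
  set e := optionEquivLeft (Option Unit) ℂ
  have h1 : e f ∣ PowerSeries.C y := by
    rw [← rename_some_eq]
    exact map_dvd e h
  have h2 : ¬ IsUnit (e f) := by
    rw [MulEquiv.isUnit_map e, MvPowerSeries.isUnit_iff_constantCoeff, hf]
    simp
  obtain ⟨p, hp, hpf⟩ := PowerSeries.exists_prime_C_dvd hy h2 h1
  rw [← rename_some_eq] at hpf
  refine ⟨p, hp, ?_, ?_, (map_dvd_iff e).1 hpf⟩
  · by_contra hne
    exact hp.not_isUnit (MvPowerSeries.isUnit_iff_constantCoeff.2 (isUnit_iff_ne_zero.2 hne))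
  · rw [← MulEquiv.prime_iff (e := e), rename_some_eq]
    exact PowerSeries.prime_C hp

/-- Monomials involving a variable outside the range of `e` vanish and the others are reindexed.
Restriction to a coordinate subspace thus becomes accessible both to coefficients and to composition
of substitutions. -/
theorem subst_eq_killCompl {σ τ : Type*} [Finite τ] (e : σ ↪ τ) {a : τ → MvPowerSeries σ ℂ}
    (ha : ∀ i, a (e i) = X i) (ha' : ∀ i ∉ Set.range e, a i = 0) (f : MvPowerSeries τ ℂ) :
    subst a f = killCompl e f := by
  classical
  have hs : HasSubst a := hasSubst_of_constantCoeff_zero fun i => by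
    by_cases h : i ∈ Set.range e
    · obtain ⟨j, rfl⟩ := h
      rw [ha, constantCoeff_X]
    · rw [ha' i h, map_zero]
  ext x
  rw [coeff_subst hs, coeff_killCompl, finsum_eq_single _ (Finsupp.embDomain e x)]
  · rw [Finsupp.prod_embDomain]
    simp [ha, ← monomial_one_eq]
  · intro d hd
    by_cases h : ∃ y, Finsupp.embDomain e y = d
    · obtain ⟨y, rfl⟩ := h
      have : x ≠ y := fun h => hd (by rw [h])
      rw [Finsupp.prod_embDomain]
      simp [ha, ← monomial_one_eq, coeff_monomial, this]
    · have : ∃ i ∈ d.support, i ∉ Set.range e := by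
        by_contra! hc
        exact h ((Finsupp.mem_range_embDomain_iff e d).2 fun i hi => hc i hi)
      obtain ⟨i, hi, hir⟩ := this
      have : (d.prod fun s k => a s ^ k) = 0 := by
        refine Finset.prod_eq_zero hi ?_
        simp only
        rw [ha' i hir, zero_pow (Finsupp.mem_support_iff.1 hi)]
      rw [this]
      simp

/-- Since `e` reaches every variable except possibly `t`, the coefficients of monomials free of `t`
are all seen by `killCompl`. -/
theorem X_dvd_of_killCompl_eq_zero {σ τ : Type*} (e : σ ↪ τ) {t : τ}
    (ht : ∀ i, i ≠ t → i ∈ Set.range e) {f : MvPowerSeries τ ℂ} (hf : killCompl e f = 0) :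
    X t ∣ f := by
  rw [X_dvd_iff]
  intro m hm
  obtain ⟨y, rfl⟩ := (Finsupp.mem_range_embDomain_iff e m).2 fun i hi => ht i fun h => by
    subst h
    exact Finsupp.mem_support_iff.1 (Finset.mem_coe.1 hi) hm
  rw [← coeff_killCompl, hf, map_zero]

theorem exists_eq_X_pow_mul {σ : Type*} [Finite σ] (i : σ) {f : MvPowerSeries σ ℂ} (hf : f ≠ 0) :
    ∃ (l : ℕ) (g : MvPowerSeries σ ℂ), f = X i ^ l * g ∧ ¬ X i ∣ g := by
  have hX : ¬ IsUnit (X i : MvPowerSeries σ ℂ) := by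
    rw [MvPowerSeries.isUnit_iff_constantCoeff]
    simp
  obtain ⟨g, h1, h2⟩ := (FiniteMultiplicity.of_not_isUnit hX hf).exists_eq_pow_mul_and_not_dvd
  exact ⟨_, g, h1, h2⟩

/-- A nonzero power series stays nonzero along a generic choice of lines. -/
theorem exists_subst_smul_X_ne_zero {σ τ : Type*} [Finite σ] (π : σ → τ) {f : MvPowerSeries σ ℂ}
    (hf : f ≠ 0) : ∃ c : σ → ℂ, subst (fun i => c i • (X (π i) : MvPowerSeries τ ℂ)) f ≠ 0 := by
  classical
  obtain ⟨d₀, hd₀⟩ := (ne_zero_iff_exists_coeff_ne_zero f).1 hf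
  have hfin := Filter.TendstoCofinite.finite_preimage_singleton (Finsupp.mapDomain π (M := ℕ))
    (d₀.mapDomain π)
  -- The value of `P` at `c` is the coefficient of the substituted series at the exponent
  -- `d₀.mapDomain π`: it gathers all monomials of `f` that merge into this one, finitely many.
  set P : MvPolynomial σ ℂ := ∑ d ∈ hfin.toFinset, MvPolynomial.monomial d (coeff d f)
  have hP : P ≠ 0 := by
    intro h
    apply hd₀
    have := congrArg (MvPolynomial.coeff d₀) h
    simpa [P, MvPolynomial.coeff_sum, MvPolynomial.coeff_monomial] using this
  obtain ⟨c, hc⟩ : ∃ c, MvPolynomial.eval c P ≠ 0 := by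
    by_contra! h
    exact hP (MvPolynomial.funext fun x => by rw [h x, map_zero])
  refine ⟨c, fun h => hc ?_⟩
  have e : subst (fun i => c i • (X (π i) : MvPowerSeries τ ℂ)) f = rename π (rescale c f) := by
    rw [rename_eq_subst, rescale_eq_subst, subst_comp_subst_apply (HasSubst.smul_X c)
      (HasSubst.X_comp π)]
    congr 1
    funext i
    rw [Pi.smul_apply', subst_smul (HasSubst.X_comp π), subst_X (HasSubst.X_comp π)]
    rfl
  rw [e] at h
  have := congrArg (coeff (d₀.mapDomain π)) h
  rw [coeff_rename, map_zero] at this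
  rw [← this]
  simp only [P, map_sum, MvPolynomial.eval_monomial, coeff_rescale]
  refine Finset.sum_congr rfl fun d _ => ?_
  rw [mul_comm]

end MvPowerSeries

/-! ### Composition of substitutions -/

namespace MvPowerSeries

theorem subst_apply_zero {σ τ : Type*} {a : σ → MvPowerSeries τ ℂ} (ha : HasSubst a) :
    subst a (0 : MvPowerSeries σ ℂ) = 0 := by
  rw [← coe_substAlgHom ha, map_zero]

theorem X_ne_zero {σ : Type*} (i : σ) : (X i : MvPowerSeries σ ℂ) ≠ 0 := fun h => by
  classical
  have := congrArg (coeff (Finsupp.single i 1)) h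
  simp [coeff_X] at this

theorem subst_subst_of_constantCoeff {σ τ ρ : Type*} [Finite σ] [Finite τ]
    {a : σ → MvPowerSeries τ ℂ} {b : τ → MvPowerSeries ρ ℂ}
    (ha : ∀ i, constantCoeff (a i) = 0) (hb : ∀ i, constantCoeff (b i) = 0)
    {c : σ → MvPowerSeries ρ ℂ} (h : ∀ i, subst b (a i) = c i) (f : MvPowerSeries σ ℂ) :
    subst b (subst a f) = subst c f := by
  rw [subst_comp_subst_apply (hasSubst_of_constantCoeff_zero ha)
    (hasSubst_of_constantCoeff_zero hb)]
  exact congrArg (fun c => subst c f) (funext h)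

theorem subst_killCompl {σ τ ρ : Type*} [Finite σ] [Finite τ] (e : σ ↪ τ)
    {b : σ → MvPowerSeries ρ ℂ} (hb : ∀ i, constantCoeff (b i) = 0)
    {c : τ → MvPowerSeries ρ ℂ} (h : ∀ i, c (e i) = b i) (h' : ∀ i ∉ Set.range e, c i = 0)
    (f : MvPowerSeries τ ℂ) : subst b (killCompl e f) = subst c f := by
  classical
  set a : τ → MvPowerSeries σ ℂ := fun i => killCompl e (X i)
  have ha : ∀ i, a (e i) = X i := fun i => killCompl_X i
  have ha' : ∀ i ∉ Set.range e, a i = 0 := fun i hi => killCompl_X_eq_zero hi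
  have hb' := hasSubst_of_constantCoeff_zero hb
  rw [← subst_eq_killCompl e ha ha']
  refine subst_subst_of_constantCoeff (fun i => ?_) hb (fun i => ?_) f
  · rw [← coeff_zero_eq_constantCoeff_apply, coeff_killCompl]
    simp
  · by_cases hi : i ∈ Set.range e
    · obtain ⟨i, rfl⟩ := hi
      rw [ha, subst_X hb', h]
    · rw [ha' i hi, h' i hi, subst_apply_zero hb']

theorem subst_rename {σ τ ρ : Type*} [Finite σ] [Finite τ] (e : σ → τ)
    {b : τ → MvPowerSeries ρ ℂ} (hb : ∀ i, constantCoeff (b i) = 0)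
    (f : MvPowerSeries σ ℂ) : subst b (rename e f) = subst (fun i => b (e i)) f := by
  rw [rename_eq_subst]
  exact subst_subst_of_constantCoeff (fun i => by simp) hb
    (fun i => subst_X (hasSubst_of_constantCoeff_zero hb) _) f

theorem rename_subst {σ τ ρ : Type*} [Finite σ] [Finite τ] (e : τ → ρ)
    {b : σ → MvPowerSeries τ ℂ} (hb : ∀ i, constantCoeff (b i) = 0)
    (f : MvPowerSeries σ ℂ) : rename e (subst b f) = subst (fun i => rename e (b i)) f := by
  rw [rename_eq_subst]
  exact subst_subst_of_constantCoeff hb (fun i => by simp)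
    (fun i => (rename_eq_subst e _).symm) f

theorem constantCoeff_subst_of_constantCoeff {σ τ : Type*} [Finite σ]
    {a : σ → MvPowerSeries τ ℂ} (ha : ∀ i, constantCoeff (a i) = 0) (f : MvPowerSeries σ ℂ) :
    constantCoeff (subst a f) = constantCoeff f := by
  have hs := hasSubst_of_constantCoeff_zero ha
  have h0 : constantCoeff (f - C (constantCoeff f)) = 0 := by simp
  have := constantCoeff_subst_eq_zero hs ha h0
  rw [subst_sub hs, subst_C, map_sub, sub_eq_zero] at this
  rw [this, constantCoeff_C]

end MvPowerSeries

/-! ### The divisibility argument on the graph -/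

/-- If the graph `w = Q(z, χ, τ)`, in normal coordinates, is of finite type, then no nonunit
`A(z, χ, τ)` divides both `j(z, Q(z, χ, τ))` and `j̄(χ, τ)`, for a nonzero `j(z, w)`. -/
theorem constantCoeff_ne_zero_of_dvd {n : ℕ} {Q A : MvPowerSeries (Fin n ⊕ Fin (n + 1)) ℂ}
    {j : MvPowerSeries (Fin (n + 1)) ℂ}
    (hleft : subst (Sum.elim (fun _ => 0) X :
      Fin n ⊕ Fin (n + 1) → MvPowerSeries (Fin (n + 1)) ℂ) Q = X (Fin.last n))
    (hright : subst (Sum.elim (fun i => X i.castSucc) (Fin.lastCases (X (Fin.last n)) fun _ => 0) :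
      Fin n ⊕ Fin (n + 1) → MvPowerSeries (Fin (n + 1)) ℂ) Q = X (Fin.last n))
    (hQ : killCompl ((Function.Embedding.refl (Fin n)).sumMap Fin.castSuccEmb) Q ≠ 0)
    (hj : j ≠ 0)
    (hA : A ∣ subst (Fin.lastCases Q (fun i => X (Sum.inl i)) :
      Fin (n + 1) → MvPowerSeries (Fin n ⊕ Fin (n + 1)) ℂ) j)
    (hA' : A ∣ rename Sum.inr (MvPowerSeries.map (starRingEnd ℂ) j)) :
    constantCoeff A ≠ 0 := by
  intro hA0
  have hQ0 : constantCoeff Q = 0 := by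
    have := congrArg constantCoeff hleft
    rwa [constantCoeff_subst_of_constantCoeff (by rintro (i | i) <;> simp), constantCoeff_X] at this
  -- Splitting off the power of `w` leaves `g(z, 0) ≠ 0`; conjugation gives the same for `g'`.
  obtain ⟨l, g, rfl, hg⟩ := exists_eq_X_pow_mul (Fin.last n) hj
  set g' := MvPowerSeries.map (starRingEnd ℂ) g with hg'def
  have hg' : ¬ X (Fin.last n) ∣ g' := by
    rintro ⟨u, hu⟩
    apply hg
    refine ⟨MvPowerSeries.map (starRingEnd ℂ) u, ?_⟩
    have := congrArg (MvPowerSeries.map (starRingEnd ℂ)) hu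
    rw [map_mul, map_X] at this
    rw [← this]
    ext d
    simp [g']
  have hne : ∀ i : Fin (n + 1), i ≠ Fin.last n → i ∈ Set.range (Fin.castSuccEmb) :=
    fun i hi => by
      obtain ⟨k, rfl⟩ := Fin.exists_castSucc_eq.2 hi
      exact ⟨k, rfl⟩
  have hlast : ∀ i ∉ Set.range (Fin.castSuccEmb : Fin n ↪ Fin (n + 1)),
      i = Fin.last n := fun i hi => by
    by_contra h
    exact hi (hne i h)
  -- generic lines
  obtain ⟨c, hc⟩ := exists_subst_smul_X_ne_zero (τ := Option (Option Unit))
    (Sum.elim (fun _ => none) (fun _ => some none) : Fin n ⊕ Fin n → Option (Option Unit))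
    (f := killCompl ((Function.Embedding.refl (Fin n)).sumMap Fin.castSuccEmb) Q *
      (rename Sum.inl (killCompl Fin.castSuccEmb g) *
      rename Sum.inr (killCompl Fin.castSuccEmb g')))
    (mul_ne_zero hQ (mul_ne_zero
      (fun h => hg (X_dvd_of_killCompl_eq_zero _ hne (rename_injective Function.Embedding.inl
        (h.trans (map_zero _).symm))))
      (fun h => hg' (X_dvd_of_killCompl_eq_zero _ hne (rename_injective Function.Embedding.inr
        (h.trans (map_zero _).symm))))))
  have hL0 : ∀ i : Fin n ⊕ Fin n, constantCoeff (c i • (X ((Sum.elim (fun _ => none)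
      (fun _ => some none) : Fin n ⊕ Fin n → Option (Option Unit)) i) :
      MvPowerSeries (Option (Option Unit)) ℂ)) = 0 := by
    intro i
    simp
  have hL := hasSubst_of_constantCoeff_zero hL0
  -- One choice of lines serves for `Q(z, χ, 0)`, `g(z, 0)` and `g'(χ, 0)` at once, because it keeps
  -- their product nonzero.
  rw [subst_mul hL, subst_mul hL] at hc
  have hc1 := left_ne_zero_of_mul hc
  have hc2 := left_ne_zero_of_mul (right_ne_zero_of_mul hc)
  have hc3 := right_ne_zero_of_mul (right_ne_zero_of_mul hc)
  clear hc
  rw [subst_rename _ hL0] at hc2 hc3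
  -- In three variables, `none`, `some none`, `some (some ())` are `s`, `t`, `τ`; in two, `none` and
  -- `some ()` are `t` and `τ`. Here `a` restricts `(z, χ, τ)` to the lines, `b` restricts `(z, w)`
  -- along the graph, and `b'` restricts `(χ, τ)`.
  set a : Fin n ⊕ Fin (n + 1) → MvPowerSeries (Option (Option Unit)) ℂ :=
    Sum.elim (fun i => c (Sum.inl i) • X none)
      (Fin.lastCases (X (some (some ()))) fun i => c (Sum.inr i) • X (some none)) with hadef
  have ha0 : ∀ i, constantCoeff (a i) = 0 := by
    rintro (i | i)
    · simp [a]
    · induction i using Fin.lastCases <;> simp [a]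
  have ha := hasSubst_of_constantCoeff_zero ha0
  set q := subst a Q with hqdef
  have hq0 : constantCoeff q = 0 := by rw [hqdef, constantCoeff_subst_of_constantCoeff ha0, hQ0]
  set b : Fin (n + 1) → MvPowerSeries (Option (Option Unit)) ℂ :=
    Fin.lastCases q fun i => c (Sum.inl i) • X none with hbdef
  have hb0 : ∀ i, constantCoeff (b i) = 0 := by
    intro i
    induction i using Fin.lastCases <;> simp [b, hq0]
  have hb := hasSubst_of_constantCoeff_zero hb0
  set b' : Fin (n + 1) → MvPowerSeries (Option Unit) ℂ :=
    Fin.lastCases (X (some ())) fun i => c (Sum.inr i) • X none with hb'def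
  have hb'0 : ∀ i, constantCoeff (b' i) = 0 := by
    intro i
    induction i using Fin.lastCases <;> simp [b']
  have hb' := hasSubst_of_constantCoeff_zero hb'0
  have h1 : subst a A ∣ q ^ l * subst b g := by
    have h := map_dvd (substAlgHom (R := ℂ) ha) hA
    rw [coe_substAlgHom, subst_subst_of_constantCoeff (c := b) _ ha0 _, subst_mul hb, subst_pow hb,
      subst_X hb] at h
    · simpa [b] using h
    · intro i
      induction i using Fin.lastCases with
      | last => simpa using hQ0
      | cast i => simp
    · intro i
      induction i using Fin.lastCases with
      | last => simp [b, q]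
      | cast i => simp [b, subst_X ha, a]
  have h2 : subst a A ∣ rename some (X (some ()) ^ l * subst b' g') := by
    have h := map_dvd (substAlgHom (R := ℂ) ha) hA'
    have e : subst b' (X (Fin.last n) : MvPowerSeries (Fin (n + 1)) ℂ) = X (some ()) := by rw [subst_X hb']; simp [b']
    rw [coe_substAlgHom, subst_rename _ ha0] at h
    rw [← e, ← subst_pow hb', ← subst_mul hb', rename_subst _ hb'0]
    convert h using 1
    rw [map_mul, map_pow, map_X]
    congr 1
    funext i
    induction i using Fin.lastCases <;> simp [b', a]
  -- Setting `τ = 0` would otherwise contradict `hc3`.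
  have h3 : subst b' g' ≠ 0 := by
    intro h
    apply hc3
    set κ : Option Unit → MvPowerSeries (Option (Option Unit)) ℂ :=
      fun i => i.elim (X (some none)) fun _ => 0
    have hκ0 : ∀ i, constantCoeff (κ i) = 0 := by rintro (_ | i) <;> simp [κ]
    have hκ := hasSubst_of_constantCoeff_zero hκ0
    rw [subst_killCompl Fin.castSuccEmb (fun i => hL0 _)
      (c := fun i => subst κ (b' i)),
      ← subst_subst_of_constantCoeff hb'0 hκ0 (fun _ => rfl), h, subst_apply_zero hκ]
    · intro i
      simp [b', subst_smul hκ, subst_X hκ, κ]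
    · intro i hi
      rw [hlast i hi]
      simp [b', subst_X hκ, κ]
  have hA1 : constantCoeff (subst a A) = 0 := by
    rw [constantCoeff_subst_of_constantCoeff ha0, hA0]
  obtain ⟨p, hp, hp0, hP, hpA⟩ := exists_prime_rename_dvd
    (mul_ne_zero (pow_ne_zero l (X_ne_zero _)) h3) hA1 h2
  rcases hP.dvd_or_dvd (hpA.trans h1) with h | h
  · replace h := hP.dvd_of_dvd_pow h
    -- `s = 0`
    set κ : Option (Option Unit) → MvPowerSeries (Option Unit) ℂ := fun i => i.elim 0 X
    have hκ0 : ∀ i, constantCoeff (κ i) = 0 := by rintro (_ | i) <;> simp [κ]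
    have hκ := hasSubst_of_constantCoeff_zero hκ0
    -- `Q(0, χ, τ) = τ` turns `q` into `τ`, while `p` does not involve `s`.
    have h4 : p ∣ X (some ()) := by
      have := map_dvd (substAlgHom (R := ℂ) hκ) h
      rw [coe_substAlgHom, subst_rename _ hκ0] at this
      have e1 : (fun i : Option Unit => κ (some i)) = X := by funext i; simp [κ]
      have e2 : subst κ q = X (some ()) := by
        have e3 := congrArg (subst b') hleft
        rw [subst_X hb', subst_subst_of_constantCoeff (c := fun i => subst κ (a i)) _ hb'0 _] at e3
        · rw [hqdef, subst_subst_of_constantCoeff ha0 hκ0 (fun _ => rfl), e3]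
          simp [b']
        · rintro (i | i) <;> simp
        · rintro (i | i)
          · simp [a, subst_smul hκ, subst_X hκ, κ, subst_apply_zero hb']
          · induction i using Fin.lastCases <;>
              simp [a, subst_smul hκ, subst_X hκ, κ, b', subst_X hb']
      rwa [e1, subst_self, e2] at this
    have h5 : X (some ()) ∣ p := by
      obtain ⟨u, hu⟩ := h4
      -- If `u` vanished at the origin as `p` does, their product would have no linear term, yet it
      -- equals `τ`.
      have : IsUnit u := by
        by_contra hnu
        have hu0 : constantCoeff u = 0 := by
          by_contra h
          exact hnu (MvPowerSeries.isUnit_iff_constantCoeff.2 (isUnit_iff_ne_zero.2 h))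
        have := congrArg (coeff (Finsupp.single (some ()) 1)) hu
        classical
        rw [coeff_X, if_pos rfl, coeff_mul, Finsupp.antidiagonal_single] at this
        simp [Finset.Nat.antidiagonal_succ, hp0, hu0] at this
      exact this.dvd_mul_right.1 (dvd_of_eq hu)
    -- `τ = 0`
    set μ : Option (Option Unit) → MvPowerSeries (Option (Option Unit)) ℂ :=
      fun i => i.elim (X none) fun i => i.elim (X (some none)) fun _ => 0
    have hμ0 : ∀ i, constantCoeff (μ i) = 0 := by rintro (_ | _ | i) <;> simp [μ]
    have hμ := hasSubst_of_constantCoeff_zero hμ0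
    have h6 : (X (some (some ())) : MvPowerSeries (Option (Option Unit)) ℂ) ∣ q := by
      have := map_dvd (rename (R := ℂ) (some : Option Unit → Option (Option Unit))) h5
      rw [rename_X] at this
      exact this.trans h
    have h7 := map_dvd (substAlgHom (R := ℂ) hμ) h6
    rw [coe_substAlgHom, subst_X hμ] at h7
    apply hc1
    rw [subst_killCompl _ hL0 (c := fun i => subst μ (a i)),
      ← subst_subst_of_constantCoeff ha0 hμ0 (fun _ => rfl), ← zero_dvd_iff]
    · exact h7
    · rintro (i | i) <;> simp [a, subst_smul hμ, subst_X hμ, μ]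
    · rintro (i | i) hi
      · exact absurd ⟨Sum.inl i, rfl⟩ hi
      · obtain rfl := hlast i fun ⟨k, hk⟩ => hi ⟨Sum.inr k, congrArg Sum.inr hk⟩
        simp [a, subst_X hμ, μ]
  · -- `t = τ = 0`
    set κ : Option (Option Unit) → MvPowerSeries (Option (Option Unit)) ℂ :=
      fun i => i.elim (X none) fun _ => 0
    have hκ0 : ∀ i, constantCoeff (κ i) = 0 := by rintro (_ | i) <;> simp [κ]
    have hκ := hasSubst_of_constantCoeff_zero hκ0
    have h4 := map_dvd (substAlgHom (R := ℂ) hκ) h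
    rw [coe_substAlgHom, subst_rename _ hκ0] at h4
    have e1 : (fun i : Option Unit => κ (some i)) = fun _ => 0 := by funext i; simp [κ]
    have e1' : subst (fun _ : Option Unit => (0 : MvPowerSeries (Option (Option Unit)) ℂ)) p = 0 :=
      subst_zero_of_constantCoeff_zero hp0
    rw [e1, e1', zero_dvd_iff] at h4
    -- By `Q(z, 0, τ) = τ` at `τ = 0`; hence `g(cs, q)` restricts to `g(cs, 0)`.
    have e2 : subst κ q = 0 := by
      set ν : Fin (n + 1) → MvPowerSeries (Option (Option Unit)) ℂ :=
        Fin.lastCases 0 fun i => c (Sum.inl i) • X none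
      have hν0 : ∀ i, constantCoeff (ν i) = 0 := by
        intro i
        induction i using Fin.lastCases <;> simp [ν]
      have hν := hasSubst_of_constantCoeff_zero hν0
      have e3 := congrArg (subst ν) hright
      rw [subst_X hν, subst_subst_of_constantCoeff (c := fun i => subst κ (a i)) _ hν0 _] at e3
      · rw [hqdef, subst_subst_of_constantCoeff ha0 hκ0 (fun _ => rfl), e3]
        simp [ν]
      · rintro (i | i)
        · simp
        · induction i using Fin.lastCases <;> simp
      · rintro (i | i)
        · simp [a, subst_smul hκ, subst_X hκ, κ, ν, subst_X hν]
        · induction i using Fin.lastCases <;>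
            simp [a, subst_smul hκ, subst_X hκ, κ, ν, subst_X hν, subst_apply_zero hν]
    apply hc2
    rw [subst_killCompl Fin.castSuccEmb (fun i => hL0 _)
      (c := fun i => subst κ (b i)),
      ← subst_subst_of_constantCoeff hb0 hκ0 (fun _ => rfl), h4]
    · intro i
      simp [b, subst_smul hκ, subst_X hκ, κ]
    · intro i hi
      rw [hlast i hi]
      simp [b, e2]

/-! ### The chain rule and its use for renamed variables -/

namespace MvPowerSeries

section ChainRule

variable {σ τ R : Type*} [CommRing R]

open scoped WithPiTopology in
theorem continuous_pderiv [TopologicalSpace R] [IsTopologicalSemiring R] (i : σ) :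
    Continuous (pderiv R i : MvPowerSeries σ R → MvPowerSeries σ R) := by
  refine continuous_pi fun d => ?_
  change Continuous fun f => coeff d (pderiv R i f)
  simp only [coeff_pderiv]
  exact (WithPiTopology.continuous_coeff R _).mul continuous_const

open scoped WithPiTopology in
/-- The chain rule for the substitution of formal power series. -/
theorem pderiv_subst [Fintype τ] {a : τ → MvPowerSeries σ R} (ha : HasSubst a) (j : σ)
    (f : MvPowerSeries τ R) :
    pderiv R j (subst a f) = ∑ k, subst a (pderiv R k f) * pderiv R j (a k) := by
  classical
  -- With the discrete topology on coefficients both sides are continuous in `f`, so it suffices to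
  -- compare them on the dense set of polynomials.
  let _ : UniformSpace R := ⊥
  have _ : DiscreteUniformity R := ⟨rfl⟩
  have hc := continuous_subst (R := R) ha
  have key : ∀ p : MvPolynomial τ R, pderiv R j (subst a (p : MvPowerSeries τ R)) =
      ∑ k, subst a (pderiv R k (p : MvPowerSeries τ R)) * pderiv R j (a k) := by
    intro p
    induction p using MvPolynomial.induction_on with
    | C r =>
      rw [MvPolynomial.coe_C, subst_C, pderiv_C, Finset.sum_eq_zero]
      intro k _
      rw [pderiv_C, ← coe_substAlgHom ha, map_zero, zero_mul]
    | add p q hp hq =>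
      simp only [MvPolynomial.coe_add, subst_add ha, map_add, hp, hq, add_mul,
        Finset.sum_add_distrib]
    | mul_X p i hp =>
      simp only [MvPolynomial.coe_mul, MvPolynomial.coe_X, subst_mul ha, Derivation.leibniz,
        hp, smul_eq_mul, subst_add ha, subst_X ha, add_mul, Finset.sum_add_distrib, pderiv_X]
      congr 1
      · rw [Finset.sum_eq_single i]
        · rw [Pi.single_eq_same, ← coe_substAlgHom ha, map_one, mul_one]
        · intro k _ hk
          rw [Pi.single_eq_of_ne hk.symm, ← coe_substAlgHom ha, map_zero, mul_zero, zero_mul]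
        · simp
      · rw [Finset.mul_sum]
        exact Finset.sum_congr rfl fun k _ => by ring
  exact congrFun ((WithPiTopology.denseRange_toMvPowerSeries (R := R)).equalizer
    ((continuous_pderiv j).comp hc)
    (continuous_finsetSum _ fun k _ => (hc.comp (continuous_pderiv k)).mul continuous_const)
    (funext fun p => (key p).trans (by simp))) f

end ChainRule

theorem pderiv_rename {σ τ : Type*} [Fintype τ] {e : τ → σ} (he : Function.Injective e) (j : τ)
    (f : MvPowerSeries τ ℂ) : pderiv ℂ (e j) (rename e f) = rename e (pderiv ℂ j f) := by
  classical
  have hs : HasSubst (X ∘ e : τ → MvPowerSeries σ ℂ) := HasSubst.X_comp e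
  rw [rename_eq_subst, pderiv_subst hs, Finset.sum_eq_single j, rename_eq_subst]
  · simp
  · intro k _ hk
    simp [he.ne hk]
  · simp

theorem pderiv_rename_of_notMem_range {σ τ : Type*} [Fintype τ] {e : τ → σ} {i : σ}
    (hi : i ∉ Set.range e) (f : MvPowerSeries τ ℂ) : pderiv ℂ i (rename e f) = 0 := by
  classical
  have hs : HasSubst (X ∘ e : τ → MvPowerSeries σ ℂ) := HasSubst.X_comp e
  rw [rename_eq_subst, pderiv_subst hs]
  refine Finset.sum_eq_zero fun k _ => ?_
  have : e k ≠ i := fun h => hi ⟨k, h⟩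
  simp [this]

end MvPowerSeries

/-- If `M` is a square matrix whose product with a row vector `u` vanishes modulo an ideal, and an
entry of `u` is a unit, then the determinant of `M` belongs to the ideal. -/
theorem Matrix.det_mem_of_vecMul_mem {ι R : Type*} [Fintype ι] [DecidableEq ι] [CommRing R]
    {I : Ideal R} {M : Matrix ι ι R} {u : ι → R} (h : ∀ j, Matrix.vecMul u M j ∈ I) {k : ι}
    (hk : IsUnit (u k)) : M.det ∈ I := by
  have e : Matrix.vecMul (Matrix.vecMul u M) M.adjugate k = M.det * u k := by
    rw [Matrix.vecMul_vecMul, Matrix.mul_adjugate, Matrix.vecMul_smul, Matrix.vecMul_one]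
    rfl
  have : M.det * u k ∈ I := by
    rw [← e]
    exact Ideal.sum_mem _ fun j _ => I.mul_mem_right _ (h j)
  exact (Ideal.mul_unit_mem_iff_mem _ hk).1 this

/-! ### Jacobian determinants modulo `(a, r)` and transversality -/

namespace FormalCR

/-- Let `F` be a formal map of which the components indexed by `e` depend only on the variables
indexed by `e`, through the square system `G`, and the other components do not depend on them. If
`r' ∘ F = a r` and the gradient of `r'` in these directions does not vanish at the origin, then
the Jacobian determinant of `G` lies in the ideal `(a, r)`. -/
theorem rename_det_jacobian_mem {ι κ : Type} [Fintype ι] [DecidableEq ι] [Fintype κ]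
    {e : ι → κ} (he : Function.Injective e) (F : FormalMap κ κ) {G : ι → MvPowerSeries ι ℂ}
    (hF : ∀ k, F.comp (e k) = rename e (G k))
    (hF' : ∀ k ∉ Set.range e, ∀ j, pderiv ℂ (e j) (F.comp k) = 0)
    {a r r' : MvPowerSeries κ ℂ} (h : F.pullback r' = a * r)
    {k : ι} (hk : constantCoeff (pderiv ℂ (e k) r') ≠ 0) :
    rename e (jacobian G).det ∈ Ideal.span {a, r} := by
  classical
  rw [FormalMap.pullback, coe_substAlgHom] at h
  set M : Matrix ι ι (MvPowerSeries κ ℂ) := (rename e).mapMatrix (jacobian G) with hM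
  have hdet : rename e (jacobian G).det = M.det := AlgHom.map_det _ _
  rw [hdet]
  refine Matrix.det_mem_of_vecMul_mem (u := fun k => subst F.comp (pderiv ℂ (e k) r'))
    (fun j => ?_) (k := k) ?_
  · have h1 := congrArg (pderiv ℂ (e j)) h
    rw [pderiv_subst F.hasSubst, Derivation.leibniz, smul_eq_mul, smul_eq_mul] at h1
    have h2 : Matrix.vecMul (fun k => subst F.comp (pderiv ℂ (e k) r')) M j =
        a * pderiv ℂ (e j) r + r * pderiv ℂ (e j) a := by
      rw [← h1, Matrix.vecMul, dotProduct]
      -- Components of `F` outside the range of `e` have zero derivative here, so the chain rule sum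
      -- reduces to the square block.
      rw [← Finset.sum_subset (Finset.subset_univ (Finset.univ.image e)), Finset.sum_image he.injOn]
      · refine Finset.sum_congr rfl fun i _ => ?_
        rw [hF, pderiv_rename he]
        rfl
      · intro i _ hi
        rw [hF' i (by simpa using hi) j, mul_zero]
    rw [h2]
    exact Ideal.add_mem _ (Ideal.mul_mem_right _ _ (Ideal.subset_span (by simp)))
      (Ideal.mul_mem_right _ _ (Ideal.subset_span (by simp)))
  · rw [MvPowerSeries.isUnit_iff_constantCoeff,
      constantCoeff_subst_of_constantCoeff F.map_zero]
    exact isUnit_iff_ne_zero.2 hk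

theorem conjSeries_pderiv {σ : Type} (i : σ) (f : MvPowerSeries σ ℂ) :
    pderiv ℂ i (conjSeries f) = conjSeries (pderiv ℂ i f) := by
  ext d
  simp [conjSeries, coeff_pderiv]

theorem conjSeries_det_jacobian {σ : Type} [Fintype σ] [DecidableEq σ]
    (G : σ → MvPowerSeries σ ℂ) :
    conjSeries (jacobian G).det = (jacobian fun k => conjSeries (G k)).det := by
  rw [conjSeries, RingHom.map_det]
  congr 1
  ext1 i j
  exact (conjSeries_pderiv j (G i)).symm

theorem constantCoeff_conjSeries {σ : Type} (f : MvPowerSeries σ ℂ) :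
    constantCoeff (conjSeries f) = starRingEnd ℂ (constantCoeff f) := by
  simp [conjSeries]

theorem constantCoeff_pderiv_involution {ι : Type} [Fintype ι] (i : ι)
    (f : MvPowerSeries (ι ⊕ ι) ℂ) :
    constantCoeff (pderiv ℂ (Sum.inr i) (involution f)) =
      starRingEnd ℂ (constantCoeff (pderiv ℂ (Sum.inl i) f)) := by
  have : pderiv ℂ (Sum.inr i) (involution f) =
      rename (Equiv.sumComm ι ι) (pderiv ℂ (Sum.inl i) (conjSeries f)) :=
    pderiv_rename (Equiv.sumComm ι ι).injective (Sum.inl i) (conjSeries f)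
  rw [this, constantCoeff_rename, conjSeries_pderiv, constantCoeff_conjSeries]

/-- The complexified map is block diagonal in `(Z, ζ)`, so each half can be treated separately;
reality of `r'` transfers the nonvanishing gradient from `Z` to `ζ`. -/
theorem rename_jac_mem {N : ℕ} {H : FormalMap (Fin N) (Fin N)} {M' : FormalRealHypersurface N}
    {a r : MvPowerSeries (Fin N ⊕ Fin N) ℂ} (h : H.double.pullback M'.r = a * r) :
    rename Sum.inl H.jac ∈ Ideal.span {a, r} ∧
      rename Sum.inr (conjSeries H.jac) ∈ Ideal.span {a, r} := by
  obtain ⟨k, hk⟩ := M'.gradient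
  constructor
  · refine rename_det_jacobian_mem Sum.inl_injective H.double (fun k => rfl) ?_ h hk
    rintro (k | k) hk j
    · exact absurd ⟨k, rfl⟩ hk
    · exact pderiv_rename_of_notMem_range (by simp) _
  · rw [FormalMap.jac, conjSeries_det_jacobian]
    refine rename_det_jacobian_mem Sum.inr_injective H.double (fun k => rfl) ?_ h (k := k) ?_
    · rintro (k | k) hk j
      · exact pderiv_rename_of_notMem_range (by simp) _
      · exact absurd ⟨k, rfl⟩ hk
    · rw [← M'.real, constantCoeff_pderiv_involution]
      exact (map_ne_zero _).2 hk

/-- Differentiating at the origin, where `r` vanishes, gives `∂r'(dH e_j) = a(0) ∂_j r(0)`. For a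
suitable `j` this is nonzero, so the image of `dH` leaves the hyperplane `T₀^{1,0} M'`. -/
theorem isCRTransversal_of_constantCoeff_ne_zero {N : ℕ} {H : FormalMap (Fin N) (Fin N)}
    {M M' : FormalRealHypersurface N} {a : MvPowerSeries (Fin N ⊕ Fin N) ℂ}
    (h : H.double.pullback M'.r = a * M.r) (ha : constantCoeff a ≠ 0) :
    IsCRTransversal H M' := by
  obtain ⟨j, hj⟩ := M.gradient
  set L : (Fin N → ℂ) →ₗ[ℂ] ℂ := ∑ j : Fin N, constantCoeff (pderiv ℂ (Sum.inl j) M'.r) •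
      (LinearMap.proj j : (Fin N → ℂ) →ₗ[ℂ] ℂ) with hL
  set v := H.differential (Pi.single j 1) with hv
  have hLv : L v = constantCoeff a * constantCoeff (pderiv ℂ (Sum.inl j) M.r) := by
    rw [FormalMap.pullback, coe_substAlgHom] at h
    have h1 := congrArg (fun f => constantCoeff (pderiv ℂ (Sum.inl j) f)) h
    simp only [pderiv_subst H.double.hasSubst, Derivation.leibniz, smul_eq_mul, map_sum, map_add,
      map_mul, M.zero, zero_mul, add_zero, constantCoeff_subst_of_constantCoeff H.double.map_zero,
      Fintype.sum_sum_type] at h1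
    rw [← h1]
    have e1 : ∀ k, constantCoeff (pderiv ℂ (Sum.inl j) (H.double.comp (Sum.inl k))) = v k := by
      intro k
      rw [show H.double.comp (Sum.inl k) = rename Sum.inl (H.comp k) from rfl,
        pderiv_rename Sum.inl_injective, constantCoeff_rename]
      simp [v, FormalMap.differential, jacobian]
    have e2 : ∀ k, pderiv ℂ (Sum.inl j) (H.double.comp (Sum.inr k)) = 0 := fun k =>
      pderiv_rename_of_notMem_range (by simp) _
    simp [e1, e2, L]
  have hLv0 : L v ≠ 0 := by
    rw [hLv]
    exact mul_ne_zero ha hj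
  refine eq_top_iff.2 fun x _ => Submodule.mem_sup.2
    ⟨x - (L x / L v) • v, ?_, (L x / L v) • v, ?_, sub_add_cancel _ _⟩
  · change x - (L x / L v) • v ∈ LinearMap.ker L
    rw [LinearMap.mem_ker, map_sub, map_smul, smul_eq_mul, div_mul_cancel₀ _ hLv0, sub_self]
  · exact Submodule.smul_mem _ _ ⟨_, rfl⟩

end FormalCR

/-! ### Normal coordinates and the parametrization of the complexified hypersurface -/

namespace FormalCR

theorem FormalMap.subst_ne_zero_of_isChangeOfCoordinates {σ : Type} [Finite σ]
    {F : FormalMap σ σ} (hF : F.IsChangeOfCoordinates) {f : MvPowerSeries σ ℂ} (hf : f ≠ 0) :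
    subst F.comp f ≠ 0 := by
  obtain ⟨G, -, hG⟩ := hF
  intro h
  apply hf
  have : subst G.comp (subst F.comp f) = f := by
    rw [subst_subst_of_constantCoeff F.map_zero G.map_zero (c := X), subst_self, _root_.id]
    intro i
    have h : G.pullback (F.comp i) = X i := congrFun (congrArg FormalMap.comp hG) i
    rwa [FormalMap.pullback, coe_substAlgHom] at h
  rw [← this, h, subst_apply_zero G.hasSubst]

namespace FormalRealHypersurface.NormalCoordinates

variable {n : ℕ} {M : FormalRealHypersurface (n + 1)} (c : M.NormalCoordinates)

/-- The generic rank condition in the class `𝒞` forces `Q(z, χ, 0) ≠ 0`. -/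
theorem killCompl_Q_ne_zero (hn : 1 ≤ n) {k : ℕ}
    (hk : genericRank (fun α : {α : Fin n →₀ ℕ // α.degree ≤ k} => c.coeffSeries α) = n) :
    killCompl ((Function.Embedding.refl (Fin n)).sumMap Fin.castSuccEmb) c.Q ≠ 0 := by
  intro h
  have h0 : ∀ α, c.coeffSeries α = 0 := by
    intro α
    rw [coeffSeries, subst_eq_killCompl (Fin.castSuccEmb.trans Function.Embedding.inr)]
    · ext d
      rw [coeff_killCompl, coeff_apply, iteratedPDeriv, map_zero]
      -- Up to a factorial factor, each coefficient of `Q_{z^α}(0, χ, 0)` is a coefficient of `Q(z,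
      -- χ, 0)`.
      have e : Finsupp.embDomain (Fin.castSuccEmb.trans Function.Embedding.inr) d +
          α.mapDomain Sum.inl =
          Finsupp.embDomain ((Function.Embedding.refl (Fin n)).sumMap Fin.castSuccEmb)
            (d.mapDomain Sum.inr + α.mapDomain Sum.inl) := by
        simp only [Finsupp.embDomain_eq_mapDomain, Finsupp.mapDomain_add, ← Finsupp.mapDomain_comp]
        rfl
      rw [e, ← coeff_killCompl, h, map_zero, zero_mul]
    · intro i
      simp
    · rintro (i | i) hi
      · rfl
      · induction i using Fin.lastCases with
        | last => simp
        | cast i => exact absurd ⟨i, rfl⟩ hi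
  have : jacobian (fun α : {α : Fin n →₀ ℕ // α.degree ≤ k} => c.coeffSeries α) = 0 := by
    ext1 i j
    simp [jacobian, h0]
  rw [genericRank, this, Matrix.rank_zero] at hk
  omega

theorem constantCoeff_Q : constantCoeff c.Q = 0 := by
  have := congrArg constantCoeff c.normal_left
  rwa [constantCoeff_subst_of_constantCoeff (by rintro (i | i) <;> simp), constantCoeff_X] at this

/-- The map `(z, χ, τ) ↦ (Z(z, Q(z, χ, τ)), Z̄(χ, τ))` parametrizing the complexification of `M`
annihilates the ideal of `M`; composed with it, functions of `Z` become functions of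
`(z, Q(z, χ, τ))`, and functions of `ζ` become functions of `(χ, τ)`. -/
theorem exists_algHom : ∃ Φ : MvPowerSeries (Fin (n + 1) ⊕ Fin (n + 1)) ℂ →ₐ[ℂ]
      MvPowerSeries (Fin n ⊕ Fin (n + 1)) ℂ,
    Φ M.r = 0 ∧ (∀ f, constantCoeff (Φ f) = constantCoeff f) ∧
    (∀ f, Φ (rename Sum.inl f) = subst (Fin.lastCases c.Q (fun i => X (Sum.inl i)) :
      Fin (n + 1) → MvPowerSeries (Fin n ⊕ Fin (n + 1)) ℂ) (subst c.Z.comp f)) ∧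
    ∀ f, Φ (rename Sum.inr (conjSeries f)) =
      rename Sum.inr (conjSeries (subst c.Z.comp f)) := by
  set θ : Fin (n + 1) ⊕ Fin (n + 1) → MvPowerSeries (Fin n ⊕ Fin (n + 1)) ℂ :=
    Sum.elim (Fin.lastCases c.Q (fun i => X (Sum.inl i))) (fun i => X (Sum.inr i)) with hθdef
  have hθ0 : ∀ i, constantCoeff (θ i) = 0 := by
    rintro (i | i)
    · induction i using Fin.lastCases <;> simp [θ, c.constantCoeff_Q]
    · simp [θ]
  have hθ := hasSubst_of_constantCoeff_zero hθ0
  refine ⟨(substAlgHom hθ).comp c.Z.double.pullback, ?_, fun f => ?_, fun f => ?_, fun f => ?_⟩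
  · have h : c.Z.double.pullback M.r ∈ Ideal.span {X (Sum.inl (Fin.last n)) -
        rename (Sum.map Fin.castSucc _root_.id) c.Q} := by
      rw [← c.defining]
      exact Ideal.mem_span_singleton_self _
    obtain ⟨u, hu⟩ := Ideal.mem_span_singleton.1 h
    rw [AlgHom.comp_apply, hu, map_mul, map_sub, coe_substAlgHom, subst_X hθ, subst_rename _ hθ0]
    have : (fun i => θ (Sum.map Fin.castSucc _root_.id i)) = X := by
      funext i
      rcases i with i | i <;> simp [θ]
    rw [this, subst_self]
    simp [θ]
  · rw [AlgHom.comp_apply, coe_substAlgHom, constantCoeff_subst_of_constantCoeff hθ0,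
      FormalMap.pullback, coe_substAlgHom,
      constantCoeff_subst_of_constantCoeff c.Z.double.map_zero]
  · rw [AlgHom.comp_apply, coe_substAlgHom, FormalMap.pullback, coe_substAlgHom,
      subst_rename _ c.Z.double.map_zero]
    have : subst (fun i => c.Z.double.comp (Sum.inl i)) f = rename Sum.inl (subst c.Z.comp f) :=
      (rename_subst Sum.inl c.Z.map_zero f).symm
    rw [this, subst_rename _ hθ0]
    rfl
  · rw [AlgHom.comp_apply, coe_substAlgHom, FormalMap.pullback, coe_substAlgHom,
      subst_rename _ c.Z.double.map_zero]
    have h1 : subst (fun i => c.Z.double.comp (Sum.inr i)) (conjSeries f) =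
        rename Sum.inr (subst (fun i => conjSeries (c.Z.comp i)) (conjSeries f)) :=
      (rename_subst Sum.inr (fun i => by
        rw [constantCoeff_conjSeries, c.Z.map_zero, _root_.map_zero]) (conjSeries f)).symm
    have h2 : subst (fun i => conjSeries (c.Z.comp i)) (conjSeries f) =
        conjSeries (subst c.Z.comp f) := (map_subst c.Z.hasSubst f).symm
    rw [h1, h2, subst_rename _ hθ0, rename_eq_subst]
    rfl

end FormalRealHypersurface.NormalCoordinates

end FormalCR

theorem corollary2p3 {n : ℕ} (hn : 1 ≤ n) (M M' : FormalCR.FormalRealHypersurface (n + 1))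
    (hM : M.InClassC) (H : FormalCR.FormalMap (Fin (n + 1)) (Fin (n + 1)))
    (hH : FormalCR.SendsInto H M M') (hJac : H.jac ≠ 0) :
    FormalCR.IsCRTransversal H M' := by
  obtain ⟨c, k, hk⟩ := hM
  have hr : H.double.pullback M'.r ∈ M.ideal :=
    Ideal.mem_comap.1 (hH (Ideal.mem_span_singleton_self _))
  obtain ⟨a, ha⟩ := Ideal.mem_span_singleton'.1 hr
  refine FormalCR.isCRTransversal_of_constantCoeff_ne_zero ha.symm ?_
  obtain ⟨h1, h2⟩ := FormalCR.rename_jac_mem ha.symm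
  obtain ⟨Φ, hΦr, hΦ0, hΦl, hΦr'⟩ := c.exists_algHom
  -- As `Φ` kills `r`, membership in `(a, r)` becomes divisibility by `Φ a`.
  have hdvd : ∀ f ∈ Ideal.span {a, M.r}, Φ a ∣ Φ f := by
    intro f hf
    obtain ⟨x, y, rfl⟩ := Ideal.mem_span_pair.1 hf
    rw [map_add, map_mul, map_mul, hΦr, mul_zero, add_zero]
    exact dvd_mul_left _ _
  rw [← hΦ0]
  refine constantCoeff_ne_zero_of_dvd c.normal_left c.normal_right
    (c.killCompl_Q_ne_zero hn (hk k le_rfl))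
    (FormalCR.FormalMap.subst_ne_zero_of_isChangeOfCoordinates c.isChange hJac) ?_ ?_
  · rw [← hΦl]
    exact hdvd _ h1
  · rw [← FormalCR.conjSeries, ← hΦr']
    exact hdvd _ h2
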